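/- Consider the full-information online decision problem with $K \ge 2$ actions and $T$ steps. At step $t$ the learner chooses an action $a_t \in \{1,\dots,K\}$ and suffers the loss $\ell_{t,a_t}$, after which the whole loss vector $\ell_t \in [0,1]^K$ is revealed; the losses $\ell_{t,i}$ (for all $t$ and $i$) are drawn independently, $\ell_{t,i}$ from a distribution on $[0,1]$ with mean $\mu_{t,i}$ that may depend on $t$ and $i$. A (randomized) full-information algorithm chooses $a_t$ as a measurable function of $\ell_1,\dots,\ell_{t-1}$ and of internal randomness that is independent of the losses; it may know $K$, $T$ and the parameters $\Gamma,\Lambda$ below. Its expected dynamic regret is $\sum_{t=1}^T \bigl(\mathbb{E}[\ell_{t,a_t}] - \min_i \mu_{t,i}\bigr)$. For an environment put $$\Gamma_{\rm env} = 1+\#\{2\le t\le T : \mu_t \ne \mu_{t-1}\}, \qquad \Lambda_{\rm env} = \sum_{t=1}^T \mathbb{E}\bigl[\|\ell_t-\mu_t\|_2^2\bigr].$$ **Theorem.** For every $C>0$ there is a constant $c>0$, depending only on $C$, such that for all integers $K\ge 2$ and $1\le\Gamma\le T$, all real $0\le\Lambda\le C\,T$, and every full-information algorithm with $K$ actions and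 horizon $T$, there is an environment with $\Gamma_{\rm env}\le\Gamma$ and $\Lambda_{\rm env}\le\Lambda$ on which the expected dynamic regret of the algorithm is at least $c\,(\sqrt{\Gamma\Lambda}+\Gamma)$. In other words, the worst-case expected dynamic regret of every full-information algorithm is $\Omega(\sqrt{\Gamma\Lambda}+\Gamma)$. -/

import Mathlib

open MeasureTheory

noncomputable section

/-- A non-stationary stochastic environment with `K` actions and `T` steps. At step `t` the loss of
action `i` is drawn from `law t i`, a probability distribution on `[0,1]`; all the losses are
independent. -/
structure LossEnvironment (K T : ℕ) where
  law : Fin T → Fin K → Measure unitInterval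
  isProb : ∀ t i, IsProbabilityMeasure (law t i)

namespace LossEnvironment

variable {K T : ℕ} (E : LossEnvironment K T)

instance (t : Fin T) (i : Fin K) : IsProbabilityMeasure (E.law t i) := E.isProb t i

/-- The law of the loss vector `ℓ_t`. -/
def stepLaw (t : Fin T) : Measure (Fin K → unitInterval) := Measure.pi (E.law t)

instance (t : Fin T) : IsProbabilityMeasure (E.stepLaw t) := by
  unfold stepLaw; infer_instance

/-- The joint law of the loss vectors `(ℓ_t)_t`. -/
def jointLaw : Measure (Fin T → Fin K → unitInterval) := Measure.pi E.stepLaw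

instance : IsProbabilityMeasure E.jointLaw := by
  unfold jointLaw; infer_instance

/-- The mean loss vector `μ_t`. -/
def mean (t : Fin T) (i : Fin K) : ℝ := ∫ x, (x : ℝ) ∂(E.law t i)

open Classical in
/-- `Γ = 1 + #{t ≥ 2 : μ_t ≠ μ_{t-1}}`. -/
def numIntervals : ℕ :=
  1 + (Finset.univ.filter
    (fun t : Fin T => ∃ s : Fin T, s.val + 1 = t.val ∧ E.mean t ≠ E.mean s)).card

/-- `Λ = ∑_t 𝔼 ‖ℓ_t - μ_t‖₂²`. -/
def totalVariance : ℝ :=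
  ∑ t : Fin T, ∫ x, ∑ i : Fin K, ((x i : ℝ) - E.mean t i) ^ 2 ∂(E.stepLaw t)

end LossEnvironment

/-- A randomized full-information algorithm with `K` actions and horizon `T`, with internal
randomness (a seed) in `Ω`. The action of step `t` is a measurable function of the seed and of all
the loss vectors of the earlier steps. The past actions of the algorithm are themselves
functions of these data, so letting the algorithm use them as well adds no generality. -/
structure FullInfoAlgorithm (K T : ℕ) (Ω : Type*) [MeasurableSpace Ω] where
  act : (t : Fin T) → Ω → (Fin t.val → Fin K → unitInterval) → Fin K
  measurable_act : ∀ t : Fin T,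
    Measurable (fun p : Ω × (Fin t.val → Fin K → unitInterval) => act t p.1 p.2)

namespace FullInfoAlgorithm

variable {K T : ℕ} {Ω : Type*} [MeasurableSpace Ω]

/-- The action `a_t` played when the seed is `ω` and the losses are `ℓ`: only the losses of the
steps before `t` are read. -/
def play (A : FullInfoAlgorithm K T Ω) (t : Fin T) (ω : Ω) (ℓ : Fin T → Fin K → unitInterval) :
    Fin K :=
  A.act t ω (fun s => ℓ (Fin.castLE t.isLt.le s))

/-- The expected dynamic pseudo-regret `∑_t (𝔼 ℓ_{t,a_t} - min_i μ_{t,i})` when the seed has law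
`P` and is independent of the losses. -/
def regret (A : FullInfoAlgorithm K T Ω) (P : Measure Ω) (E : LossEnvironment K T) : ℝ :=
  ∑ t : Fin T,
    ((∫ z, ((z.2 t (A.play t z.1 z.2) : unitInterval) : ℝ) ∂(P.prod E.jointLaw))
      - ⨅ i : Fin K, E.mean t i)

end FullInfoAlgorithm

end

/-! Cut `Γ * L` steps into `Γ` blocks of length `L`. In each block action `1` has loss `1/2`, action
`0` has a fair-looking `0/1` loss with mean `(1 ± δ)/2`, the sign being fixed per block, and every
other action has loss `1`. A block offers at most `L - 1` earlier samples, so with `δ ≈ 1/√L` its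
sign stays uncertain and each step costs order `δ`, in total `Γ * L * δ ≈ Γ√L`. The variance is at
most `Γ * L / 4`; taking `Γ * L ≈ min T Λ` gives `√(ΓΛ)`. If `Λ ≤ Γ`, noiseless blocks of one step
(`L = δ = 1`) give order `Γ`. The indistinguishability is `le_sum_signVectorWeight_test`.
`le_sum_seedRegret` averages it over all sign patterns, for each fixed seed, and `exists_le_regret`
integrates over the seed and picks a bad pattern. -/

noncomputable section

/-! ### Products of sign laws and two-point testing -/

section SignVectors

variable {ι : Type*} [DecidableEq ι]

/-- The sign `±1` encoded by a Boolean. -/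
def boolSign (y : Bool) : ℝ := if y then 1 else -1

@[simp] lemma boolSign_true : boolSign true = 1 := rfl
@[simp] lemma boolSign_false : boolSign false = -1 := rfl

lemma boolSign_not (y : Bool) : boolSign (!y) = -boolSign y := by cases y <;> simp

lemma boolSign_sq (y : Bool) : boolSign y ^ 2 = 1 := by cases y <;> simp

/-- Negate the coordinate `t` of a Boolean vector. -/
def flipAt (t : ι) (x : ι → Bool) : ι → Bool := Function.update x t (!x t)

@[simp] lemma flipAt_same (t : ι) (x : ι → Bool) : flipAt t x t = !x t := by simp [flipAt]

lemma flipAt_of_ne {s t : ι} (h : s ≠ t) (x : ι → Bool) : flipAt t x s = x s := by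
  simp [flipAt, h]

lemma flipAt_involutive (t : ι) : Function.Involutive (flipAt t) := by
  intro x
  ext s
  by_cases h : s = t
  · subst h; simp
  · simp [flipAt_of_ne h]

variable [Fintype ι]

lemma sum_flipAt (t : ι) (F : (ι → Bool) → ℝ) : ∑ x, F (flipAt t x) = ∑ x, F x :=
  (flipAt_involutive t).bijective.sum_comp F

/-- Pairing `x` with its flip reduces an identity between sums over the cube to a two-term identity.
-/
lemma sum_eq_sum_of_flipAt_add_eq (t : ι) {F G : (ι → Bool) → ℝ}
    (h : ∀ x, F x + F (flipAt t x) = G x + G (flipAt t x)) : ∑ x, F x = ∑ x, G x := by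
  have := Finset.sum_congr (rfl : (Finset.univ : Finset (ι → Bool)) = _) (fun x _ => h x)
  rw [Finset.sum_add_distrib, Finset.sum_add_distrib, sum_flipAt, sum_flipAt] at this
  linarith

/-- The probability of the sign `y` when the mean sign is `θ`. -/
def signWeight (θ : ℝ) (y : Bool) : ℝ := (1 + θ * boolSign y) / 2

/-- The probability of the sign vector `x` when the signs are independent with means `θ`. -/
def signVectorWeight (θ : ι → ℝ) (x : ι → Bool) : ℝ := ∏ t, signWeight (θ t) (x t)

lemma signWeight_nonneg {θ : ℝ} (hθ : |θ| ≤ 1) (y : Bool) : 0 ≤ signWeight θ y := by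
  have := abs_le.1 hθ
  cases y <;> simp [signWeight] <;> linarith

omit [DecidableEq ι] in
lemma signVectorWeight_nonneg {θ : ι → ℝ} (hθ : ∀ t, |θ t| ≤ 1) (x : ι → Bool) :
    0 ≤ signVectorWeight θ x :=
  Finset.prod_nonneg fun t _ => signWeight_nonneg (hθ t) _

lemma sum_signVectorWeight (θ : ι → ℝ) : ∑ x, signVectorWeight θ x = 1 := by
  unfold signVectorWeight
  rw [← Fintype.piFinset_univ, Finset.sum_prod_piFinset]
  refine Finset.prod_eq_one fun t _ => ?_
  simp [signWeight]
  ring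

lemma signVectorWeight_eq_mul (θ : ι → ℝ) (t : ι) (x : ι → Bool) :
    signVectorWeight θ x =
      signWeight (θ t) (x t) * ∏ s ∈ Finset.univ.erase t, signWeight (θ s) (x s) :=
  (Finset.mul_prod_erase _ _ (Finset.mem_univ t)).symm

lemma prod_erase_flipAt (θ : ι → ℝ) (t : ι) (x : ι → Bool) :
    ∏ s ∈ Finset.univ.erase t, signWeight (θ s) (flipAt t x s) =
      ∏ s ∈ Finset.univ.erase t, signWeight (θ s) (x s) :=
  Finset.prod_congr rfl fun s hs => by rw [flipAt_of_ne (Finset.ne_of_mem_erase hs)]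

/-- A statistic that does not read the coordinate `t` is uncorrelated with the sign `t`. -/
lemma sum_signVectorWeight_mul_sub (θ : ι → ℝ) (t : ι) {h : (ι → Bool) → ℝ}
    (hh : ∀ x, h (flipAt t x) = h x) :
    ∑ x, signVectorWeight θ x * ((boolSign (x t) - θ t) * h x) = 0 := by
  rw [← Finset.sum_const_zero (ι := ι → Bool) (s := Finset.univ)]
  refine sum_eq_sum_of_flipAt_add_eq t fun x => ?_
  rw [signVectorWeight_eq_mul θ t, signVectorWeight_eq_mul θ t, prod_erase_flipAt, hh, flipAt_same,
    boolSign_not]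
  unfold signWeight
  rw [boolSign_not]
  linear_combination (θ t * h x * ∏ s ∈ Finset.univ.erase t, (1 + θ s * boolSign (x s)) / 2) *
    boolSign_sq (x t)

/-- The law of a statistic that does not read the coordinate `t` does not depend on `θ t`. -/
lemma sum_signVectorWeight_update (θ : ι → ℝ) (t : ι) (c : ℝ) {h : (ι → Bool) → ℝ}
    (hh : ∀ x, h (flipAt t x) = h x) :
    ∑ x, signVectorWeight (Function.update θ t c) x * h x = ∑ x, signVectorWeight θ x * h x := by
  have key : ∀ x : ι → Bool, ∏ s ∈ Finset.univ.erase t, signWeight (Function.update θ t c s) (x s) =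
      ∏ s ∈ Finset.univ.erase t, signWeight (θ s) (x s) := fun x =>
    Finset.prod_congr rfl fun s hs => by
      rw [Function.update_of_ne (Finset.ne_of_mem_erase hs)]
  refine sum_eq_sum_of_flipAt_add_eq t fun x => ?_
  simp only [signVectorWeight_eq_mul _ t, key, prod_erase_flipAt, hh, flipAt_same]
  simp only [signWeight, boolSign_not, Function.update_self]
  ring

/-- With `y = p + q`, `p * y ≥ p * q = κ * R ^ 2 ≥ κ * (y * R - y ^ 2 / 4)`; divide by `y`. The
bound is linear in `p`, `q`, `R`, so it can be summed over sign vectors. -/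
lemma mul_sub_le_of_mul_eq {p q R κ : ℝ} (hp : 0 ≤ p) (hq : 0 ≤ q)
    (h : p * q = κ * R ^ 2) (hκ : 0 ≤ κ) : κ * (R - (p + q) / 4) ≤ p := by
  rcases (add_nonneg hp hq).eq_or_lt' with hy | hy
  · have hp0 : p = 0 := by linarith
    have hq0 : q = 0 := by linarith
    subst hp0 hq0
    have : κ * R = 0 := by
      rcases mul_eq_zero.1 (h.symm.trans (by ring)) with h | h
      · simp [h]
      · simp [pow_eq_zero_iff (two_ne_zero) |>.1 h]
    linarith
  · refine le_of_mul_le_mul_right ?_ hy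
    nlinarith [mul_nonneg hκ (sq_nonneg (R - (p + q) / 2)), mul_nonneg hp hp]

/-- Two-point testing bound: two products of sign laws whose means agree up to signs cannot be
told apart better than the product of `1 - θ²` over the coordinates in which they differ. -/
lemma le_sum_signVectorWeight_test {θ θ' : ι → ℝ} (hθ : ∀ t, |θ t| ≤ 1) (D : Finset ι)
    (hD : ∀ t ∈ D, θ' t = -θ t) (hD' : ∀ t ∉ D, θ' t = θ t) {h : (ι → Bool) → ℝ}
    (h0 : ∀ x, 0 ≤ h x) (h1 : ∀ x, h x ≤ 1) :
    (∏ t ∈ D, (1 - θ t ^ 2)) / 2 ≤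
      ∑ x, signVectorWeight θ x * h x + ∑ x, signVectorWeight θ' x * (1 - h x) := by
  set κ := ∏ t ∈ D, (1 - θ t ^ 2) with hκ
  have hκ0 : 0 ≤ κ := Finset.prod_nonneg fun t _ => by
    have := (sq_le_one_iff_abs_le_one _).2 (hθ t); linarith
  have hθ' : ∀ t, |θ' t| ≤ 1 := fun t => by
    by_cases ht : t ∈ D
    · rw [hD t ht, abs_neg]; exact hθ t
    · rw [hD' t ht]; exact hθ t
  -- The midpoint law: on `D` the product of the two weights is `(1 - θ²)/4`, that is `1 - θ²` times
  -- the squared fair weight.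
  set θ₀ : ι → ℝ := fun t => if t ∈ D then 0 else θ t with hθ₀
  have hprod : ∀ x, signVectorWeight θ x * signVectorWeight θ' x =
      κ * signVectorWeight θ₀ x ^ 2 := fun x => by
    have : κ = ∏ t, if t ∈ D then (1 - θ t ^ 2) else 1 := by
      rw [Finset.prod_ite_mem, Finset.univ_inter]
    rw [this]
    unfold signVectorWeight
    rw [← Finset.prod_mul_distrib, ← Finset.prod_pow, ← Finset.prod_mul_distrib]
    refine Finset.prod_congr rfl fun t _ => ?_
    by_cases ht : t ∈ D
    · simp only [hD t ht, hθ₀, ht, if_true, signWeight]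
      linear_combination (-(θ t ^ 2) / 4) * boolSign_sq (x t)
    · simp only [hD' t ht, hθ₀, ht, if_false]
      ring
  have hpt : ∀ x, κ * (signVectorWeight θ₀ x -
      (signVectorWeight θ x + signVectorWeight θ' x) / 4) ≤
      signVectorWeight θ x * h x + signVectorWeight θ' x * (1 - h x) := fun x => by
    have hp := signVectorWeight_nonneg hθ x
    have hq := signVectorWeight_nonneg hθ' x
    have e1 := mul_sub_le_of_mul_eq hp hq (hprod x) hκ0
    have e2 := mul_sub_le_of_mul_eq hq hp ((mul_comm _ _).trans (hprod x)) hκ0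
    rw [add_comm (signVectorWeight θ' x)] at e2
    have := mul_le_mul_of_nonneg_right e1 (h0 x)
    have := mul_le_mul_of_nonneg_right e2 (sub_nonneg.2 (h1 x))
    linarith
  rw [← Finset.sum_add_distrib]
  -- All three weights have total mass `1`, so the left side sums to `κ * (1 - 2 / 4)`.
  refine le_trans (le_of_eq ?_) (Finset.sum_le_sum fun x _ => hpt x)
  rw [← Finset.mul_sum, Finset.sum_sub_distrib, ← Finset.sum_div, Finset.sum_add_distrib]
  simp only [sum_signVectorWeight]
  ring

end SignVectors

/-! ### Sign laws as measures -/

section SignMeasure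

/-- The law of a random sign with mean `θ`. -/
def signMeasure (θ : ℝ) : Measure Bool :=
  ENNReal.ofReal (signWeight θ true) • Measure.dirac true +
    ENNReal.ofReal (signWeight θ false) • Measure.dirac false

lemma isProbabilityMeasure_signMeasure {θ : ℝ} (hθ : |θ| ≤ 1) :
    IsProbabilityMeasure (signMeasure θ) := by
  constructor
  simp only [signMeasure, Measure.coe_add, Pi.add_apply, Measure.smul_apply, measure_univ,
    smul_eq_mul, mul_one]
  rw [← ENNReal.ofReal_add (signWeight_nonneg hθ _) (signWeight_nonneg hθ _),
    ENNReal.ofReal_eq_one]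
  simp [signWeight]
  ring

lemma signMeasure_singleton (θ : ℝ) (y : Bool) :
    signMeasure θ {y} = ENNReal.ofReal (signWeight θ y) := by
  cases y <;> simp [signMeasure]

lemma integral_signMeasure {θ : ℝ} (hθ : |θ| ≤ 1) (f : Bool → ℝ) :
    ∫ y, f y ∂(signMeasure θ) = signWeight θ true * f true + signWeight θ false * f false := by
  have := isProbabilityMeasure_signMeasure hθ
  rw [integral_fintype Integrable.of_finite]
  simp [measureReal_def, signMeasure_singleton, ENNReal.toReal_ofReal (signWeight_nonneg hθ _)]

lemma integral_pi_signMeasure {ι : Type*} [Fintype ι] [DecidableEq ι] {θ : ι → ℝ}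
    (hθ : ∀ t, |θ t| ≤ 1) (f : (ι → Bool) → ℝ) :
    ∫ x, f x ∂(Measure.pi fun t => signMeasure (θ t)) = ∑ x, signVectorWeight θ x * f x := by
  have := fun t => isProbabilityMeasure_signMeasure (hθ t)
  rw [integral_fintype Integrable.of_finite]
  refine Finset.sum_congr rfl fun x _ => ?_
  rw [measureReal_def, Measure.pi_singleton, ENNReal.toReal_prod, smul_eq_mul]
  simp only [signMeasure_singleton, ENNReal.toReal_ofReal (signWeight_nonneg (hθ _) _)]
  rfl

/-- A family in which at most one member is not constant is independent. -/
lemma pi_map_eq_map_of_const {α κ β : Type*} [MeasurableSpace α] [MeasurableSpace β] [Fintype κ]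
    (μ : Measure α) [IsProbabilityMeasure μ] {g : κ → α → β} (hg : ∀ i, Measurable (g i))
    (i₀ : κ) (hc : ∀ i ≠ i₀, ∀ y z, g i y = g i z) :
    Measure.pi (fun i => μ.map (g i)) = μ.map (fun y i => g i y) := by
  classical
  have := fun i => Measure.isProbabilityMeasure_map (μ := μ) (hg i).aemeasurable
  have hmeas : Measurable fun y i => g i y := measurable_pi_lambda _ hg
  refine Measure.pi_eq fun s hs => ?_
  rw [Measure.map_apply hmeas (MeasurableSet.univ_pi hs),
    ← Finset.mul_prod_erase _ _ (Finset.mem_univ i₀)]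
  obtain ⟨y₀⟩ : Nonempty α := nonempty_of_isProbabilityMeasure μ
  have hpre : ∀ i ≠ i₀, g i ⁻¹' s i = if g i y₀ ∈ s i then Set.univ else ∅ := fun i hi => by
    ext y
    have := hc i hi y y₀
    split_ifs with h <;> simp [this, h]
  by_cases hall : ∀ i ≠ i₀, g i y₀ ∈ s i
  · rw [Finset.prod_eq_one, mul_one, Measure.map_apply (hg _) (hs _)]
    · congr 1
      ext y
      simp only [Set.mem_preimage, Set.mem_univ_pi]
      refine ⟨fun h => h i₀, fun h i => ?_⟩
      by_cases hi : i = i₀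
      · exact hi ▸ h
      · rw [hc i hi y y₀]; exact hall i hi
    · intro i hi
      have hi := Finset.ne_of_mem_erase hi
      rw [Measure.map_apply (hg _) (hs _), hpre i hi, if_pos (hall i hi), measure_univ]
  · push Not at hall
    obtain ⟨i, hi, hni⟩ := hall
    rw [Finset.prod_eq_zero (Finset.mem_erase.2 ⟨hi, Finset.mem_univ i⟩), mul_zero]
    · convert measure_empty (μ := μ)
      ext y
      simp only [Set.mem_preimage, Set.mem_univ_pi, Set.mem_empty_iff_false, iff_false]
      intro h
      exact hni (hc i hi y y₀ ▸ h i)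
    · rw [Measure.map_apply (hg _) (hs _), hpre i hi, if_neg hni, measure_empty]

end SignMeasure

/-! ### The hard environments -/

/-- Parameters of the hard environments: step `t` belongs to the block `block t`, and the steps in
`noisy` carry noise. The noisy steps come first. -/
structure BlockDesign (T Γ : ℕ) where
  block : Fin T → Fin Γ
  noisy : Finset (Fin T)
  gap : ℝ
  gap_nonneg : 0 ≤ gap
  gap_le_one : gap ≤ 1
  noisy_of_lt : ∀ s t, s < t → t ∈ noisy → s ∈ noisy

namespace BlockDesign

variable {K T Γ : ℕ} (D : BlockDesign T Γ) (b : Fin Γ → Bool)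

/-- The mean of the noise signs. -/
def signMean (t : Fin T) : ℝ := if t ∈ D.noisy then D.gap * boolSign (b (D.block t)) else 0

/-- The loss of action `i` at step `t` when the noise sign is `y`. -/
def lossVal (t : Fin T) (i : Fin K) (y : Bool) : ℝ :=
  if i.val = 0 then
    (1 + if t ∈ D.noisy then boolSign y else D.gap * boolSign (b (D.block t))) / 2
  else if i.val = 1 then 1 / 2 else 1

/-- The mean loss of action `i` at step `t`. -/
def meanVal (t : Fin T) (i : Fin K) : ℝ :=
  if i.val = 0 then (1 + D.gap * boolSign (b (D.block t))) / 2
  else if i.val = 1 then 1 / 2 else 1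

lemma abs_gap_mul_boolSign_le (y : Bool) : |D.gap * boolSign y| ≤ 1 := by
  have := D.gap_nonneg
  have := D.gap_le_one
  cases y <;> simp only [boolSign_true, boolSign_false, abs_le] <;> constructor <;> linarith

lemma abs_signMean_le (t : Fin T) : |D.signMean b t| ≤ 1 := by
  unfold signMean
  split_ifs
  · exact D.abs_gap_mul_boolSign_le _
  · simp

lemma lossVal_mem (t : Fin T) (i : Fin K) (y : Bool) : D.lossVal b t i y ∈ unitInterval := by
  have := abs_le.1 (D.abs_gap_mul_boolSign_le (b (D.block t)))
  unfold lossVal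
  split_ifs
  · cases y <;> simp
  · constructor <;> linarith
  · constructor <;> norm_num
  · constructor <;> norm_num

/-- The loss of action `i` at step `t` as a point of the unit interval. -/
def loss (t : Fin T) (i : Fin K) (y : Bool) : unitInterval := ⟨_, D.lossVal_mem b t i y⟩

/-- The hard environment with sign pattern `b`. -/
def env (K : ℕ) : LossEnvironment K T where
  law t i := (signMeasure (D.signMean b t)).map (D.loss b t i)
  isProb t i := by
    have := isProbabilityMeasure_signMeasure (D.abs_signMean_le b t)
    exact Measure.isProbabilityMeasure_map (measurable_of_countable _).aemeasurable

/-- Splits the loss into its mean and a centred noise whose coefficient does not depend on the sign;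
both the variance and the regret are read off from this form. -/
lemma lossVal_eq (t : Fin T) (i : Fin K) (y : Bool) :
    D.lossVal b t i y = D.meanVal b t i +
      (boolSign y - D.signMean b t) * if i.val = 0 ∧ t ∈ D.noisy then 1 / 2 else 0 := by
  unfold lossVal meanVal signMean
  by_cases h0 : i.val = 0 <;> by_cases ht : t ∈ D.noisy <;> (simp [h0, ht]; try ring)

lemma mean_env (t : Fin T) (i : Fin K) : (D.env b K).mean t i = D.meanVal b t i := by
  unfold LossEnvironment.mean env
  rw [integral_map (measurable_of_countable _).aemeasurable
    (by fun_prop), integral_signMeasure (D.abs_signMean_le b t)]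
  simp only [loss, lossVal_eq, signWeight, boolSign_true, boolSign_false]
  generalize D.signMean b t = θ
  generalize hB : (if i.val = 0 ∧ t ∈ D.noisy then (1 / 2 : ℝ) else 0) = B
  ring

/-- Only action `0` is random, so one sign can drive the whole loss vector without violating
independence. -/
lemma stepLaw_env (hK : 2 ≤ K) (t : Fin T) :
    (D.env b K).stepLaw t =
      (signMeasure (D.signMean b t)).map (fun y i => D.loss b t i y) := by
  have := isProbabilityMeasure_signMeasure (D.abs_signMean_le b t)
  refine pi_map_eq_map_of_const _ (fun i => measurable_of_countable _) ⟨0, by omega⟩ ?_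
  intro i hi y z
  have : i.val ≠ 0 := fun h => hi (Fin.ext h)
  simp [loss, lossVal, this]

lemma jointLaw_env (hK : 2 ≤ K) :
    (D.env b K).jointLaw = (Measure.pi fun t => signMeasure (D.signMean b t)).map
      (fun x t i => D.loss b t i (x t)) := by
  have := fun t => isProbabilityMeasure_signMeasure (D.abs_signMean_le b t)
  have := fun t => Measure.isProbabilityMeasure_map (μ := signMeasure (D.signMean b t))
    (f := fun y (i : Fin K) => D.loss b t i y) (measurable_of_countable _).aemeasurable
  rw [LossEnvironment.jointLaw, funext (D.stepLaw_env b hK)]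
  exact (Measure.pi_map_pi (f := fun t y (i : Fin K) => D.loss b t i y)
    fun t => (measurable_of_countable _).aemeasurable).symm

lemma totalVariance_env (hK : 2 ≤ K) :
    (D.env b K).totalVariance = D.noisy.card * ((1 - D.gap ^ 2) / 4) := by
  unfold LossEnvironment.totalVariance
  rw [← nsmul_eq_mul, ← Finset.sum_const, ← Finset.univ_inter D.noisy, ← Finset.sum_ite_mem]
  refine Finset.sum_congr rfl fun t _ => ?_
  simp only [D.stepLaw_env b hK, D.mean_env b]
  rw [integral_map (measurable_of_countable _).aemeasurable
      (by have := fun i : Fin K => measurable_subtype_coe.comp (measurable_pi_apply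
            (X := fun _ : Fin K => unitInterval) i)
          exact (Finset.measurable_sum _ fun i _ =>
            ((this i).sub_const _).pow_const 2).aestronglyMeasurable),
    integral_signMeasure (D.abs_signMean_le b t)]
  have key : ∀ y, ∑ i : Fin K, ((D.loss b t i y : ℝ) - D.meanVal b t i) ^ 2 =
      if t ∈ D.noisy then (boolSign y - D.signMean b t) ^ 2 / 4 else 0 := fun y => by
    rw [Finset.sum_eq_single (⟨0, by omega⟩ : Fin K)]
    · simp only [loss, lossVal_eq]
      split_ifs with h1 h2 h2
      · ring
      · exact absurd h1.2 h2
      · simp [h2] at h1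
      · ring
    · intro i _ hi
      have : i.val ≠ 0 := fun h => hi (Fin.ext h)
      simp [loss, lossVal_eq, this]
    · simp
  rw [key, key]
  split_ifs with h
  · simp only [signMean, if_pos h, signWeight, boolSign_true, boolSign_false]
    linear_combination (-D.gap ^ 2 / 4) * boolSign_sq (b (D.block t))
  · ring

end BlockDesign

/-! ### Regret in the hard environments -/

namespace BlockDesign

variable {K T Γ : ℕ} (D : BlockDesign T Γ) (b : Fin Γ → Bool)
  {Ω : Type*} [MeasurableSpace Ω] (A : FullInfoAlgorithm K T Ω)

/-- The action of step `t` as a function of the noise signs. -/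
def action (t : Fin T) (ω : Ω) (x : Fin T → Bool) : Fin K :=
  A.play t ω fun s i => D.loss b s i (x s)

lemma action_flipAt (t : Fin T) (ω : Ω) (x : Fin T → Bool) :
    D.action b A t ω (flipAt t x) = D.action b A t ω x := by
  unfold action FullInfoAlgorithm.play
  congr 1
  ext s i
  have : Fin.castLE t.isLt.le s ≠ t := fun h => s.isLt.ne (congrArg Fin.val h)
  simp only [flipAt_of_ne this]

/-- Everything before a noisy step is noisy, and noisy losses are functions of the signs alone.
Hence `b` acts only through the law of the signs, and the same test is faced with both laws. -/
lemma action_congr {t : Fin T} (ht : t ∈ D.noisy) (b' : Fin Γ → Bool) (ω : Ω)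
    (x : Fin T → Bool) : D.action b A t ω x = D.action b' A t ω x := by
  unfold action FullInfoAlgorithm.play
  congr 1
  ext s i
  have : Fin.castLE t.isLt.le s ∈ D.noisy := D.noisy_of_lt _ _ (Fin.lt_def.2 s.isLt) ht
  simp only [loss, lossVal, this, if_true]

/-- The smallest mean loss of a step. -/
def bestVal (t : Fin T) : ℝ := if b (D.block t) then 1 / 2 else (1 - D.gap) / 2

lemma iInf_mean_env_le (hK : 2 ≤ K) (t : Fin T) : ⨅ i, (D.env b K).mean t i ≤ D.bestVal b t := by
  have hbdd : BddBelow (Set.range ((D.env b K).mean t)) := (Set.finite_range _).bddBelow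
  by_cases h : b (D.block t)
  · refine (ciInf_le hbdd ⟨1, by omega⟩).trans (le_of_eq ?_)
    simp [mean_env, meanVal, bestVal, h]
  · refine (ciInf_le hbdd ⟨0, by omega⟩).trans (le_of_eq ?_)
    simp [mean_env, meanVal, bestVal, h]
    ring

/-- The indicator that action `i` is not the better one of the two actions `0` and `1`. -/
def wrong (t : Fin T) (i : Fin K) : ℝ :=
  if b (D.block t) then (if i.val = 0 then 1 else 0) else (if i.val = 0 then 0 else 1)

lemma gap_mul_wrong_le (t : Fin T) (i : Fin K) :
    D.gap / 2 * D.wrong b t i ≤ D.meanVal b t i - D.bestVal b t := by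
  have := D.gap_nonneg
  have := D.gap_le_one
  unfold wrong meanVal bestVal
  by_cases h : b (D.block t) <;> by_cases h0 : i.val = 0 <;> by_cases h1 : i.val = 1 <;>
    simp [h, h0, h1] <;> linarith

lemma wrong_nonneg (t : Fin T) (i : Fin K) : 0 ≤ D.wrong b t i := by
  unfold wrong; split_ifs <;> norm_num

/-- The expected regret of step `t` for a fixed seed. -/
def seedRegret (t : Fin T) (ω : Ω) : ℝ :=
  ∑ x, signVectorWeight (D.signMean b) x *
    (D.meanVal b t (D.action b A t ω x) - D.bestVal b t)

lemma gap_mul_sum_wrong_le_seedRegret (t : Fin T) (ω : Ω) :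
    D.gap / 2 * ∑ x, signVectorWeight (D.signMean b) x * D.wrong b t (D.action b A t ω x) ≤
      D.seedRegret b A t ω := by
  rw [Finset.mul_sum]
  refine Finset.sum_le_sum fun x _ => ?_
  rw [mul_left_comm]
  exact mul_le_mul_of_nonneg_left (D.gap_mul_wrong_le b t _)
    (signVectorWeight_nonneg (D.abs_signMean_le b) x)

lemma seedRegret_nonneg (t : Fin T) (ω : Ω) : 0 ≤ D.seedRegret b A t ω :=
  le_trans (mul_nonneg (div_nonneg D.gap_nonneg two_pos.le) (Finset.sum_nonneg fun x _ =>
    mul_nonneg (signVectorWeight_nonneg (D.abs_signMean_le b) x) (D.wrong_nonneg b t _)))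
    (D.gap_mul_sum_wrong_le_seedRegret b A t ω)

/-- With two opposite signs of the block of `t`, no algorithm is right in both environments. -/
lemma le_seedRegret_add_of_false {n : ℕ} {t : Fin T} (ht : t ∈ D.noisy)
    (hn : ((D.noisy.erase t).filter fun s => D.block s = D.block t).card ≤ n)
    (hb : b (D.block t) = false) (ω : Ω) :
    D.gap / 4 * (1 - D.gap ^ 2) ^ n ≤
      D.seedRegret b A t ω + D.seedRegret (flipAt (D.block t) b) A t ω := by
  set b' := flipAt (D.block t) b with hb'
  have hb't : b' (D.block t) = true := by simp [hb', hb]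
  set S := (D.noisy.erase t).filter fun s => D.block s = D.block t with hS
  set h : (Fin T → Bool) → ℝ := fun x => if (D.action b A t ω x).val = 0 then 0 else 1 with hh
  have hflip : ∀ x, h (flipAt t x) = h x := fun x => by simp only [hh, action_flipAt]
  have hw : ∀ x, D.wrong b t (D.action b A t ω x) = h x := fun x => by simp [wrong, hb, hh]
  have hw' : ∀ x, D.wrong b' t (D.action b' A t ω x) = 1 - h x := fun x => by
    rw [← D.action_congr b A ht]
    simp only [wrong, hb't, hh]
    split_ifs <;> simp
  have e1 := D.gap_mul_sum_wrong_le_seedRegret b A t ω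
  have e2 := D.gap_mul_sum_wrong_le_seedRegret b' A t ω
  simp only [hw] at e1
  simp only [hw'] at e2
  -- The action does not read the sign at `t`, so its mean may be set to `0` in both laws. This
  -- drops `t` from the product; for blocks of one step the exponent is then `0`, which allows gap
  -- `1`.
  rw [← sum_signVectorWeight_update _ t 0 hflip] at e1
  rw [← sum_signVectorWeight_update _ t 0 (fun x => by rw [hflip])] at e2
  have hle : ∀ s, |Function.update (D.signMean b) t 0 s| ≤ 1 := fun s => by
    by_cases hs : s = t
    · simp [hs]
    · simpa [hs] using D.abs_signMean_le b s
  have key := le_sum_signVectorWeight_test (θ := Function.update (D.signMean b) t 0)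
    (θ' := Function.update (D.signMean b') t 0) (h := h) hle S
    (fun s hs => by
      simp only [hS, Finset.mem_filter, Finset.mem_erase] at hs
      simp [hs.1.1, hs.1.2, signMean, hs.2, hb', boolSign_not])
    (fun s hs => by
      by_cases hst : s = t
      · simp [hst]
      · by_cases hsN : s ∈ D.noisy
        · have : D.block s ≠ D.block t := fun hbl => hs (by simp [hS, hst, hsN, hbl])
          simp [hst, signMean, hb', flipAt_of_ne this]
        · simp [hst, signMean, hsN])
    (fun x => by simp only [hh]; split_ifs <;> norm_num)
    (fun x => by simp only [hh]; split_ifs <;> norm_num)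
  have hprod : ∏ s ∈ S, (1 - Function.update (D.signMean b) t 0 s ^ 2) =
      (1 - D.gap ^ 2) ^ S.card := by
    refine Finset.prod_eq_pow_card fun s hs => ?_
    simp only [hS, Finset.mem_filter, Finset.mem_erase] at hs
    simp [hs.1.1, hs.1.2, signMean, mul_pow, boolSign_sq]
  have g0 := D.gap_nonneg
  have g1 := D.gap_le_one
  have hpow : (1 - D.gap ^ 2) ^ n ≤ (1 - D.gap ^ 2) ^ S.card :=
    pow_le_pow_of_le_one (by nlinarith) (by nlinarith) hn
  rw [hprod] at key
  have := mul_le_mul_of_nonneg_left ((div_le_div_of_nonneg_right hpow two_pos.le).trans key)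
    (div_nonneg g0 two_pos.le)
  linarith

lemma le_seedRegret_add {n : ℕ} {t : Fin T} (ht : t ∈ D.noisy)
    (hn : ((D.noisy.erase t).filter fun s => D.block s = D.block t).card ≤ n) (ω : Ω) :
    D.gap / 4 * (1 - D.gap ^ 2) ^ n ≤
      D.seedRegret b A t ω + D.seedRegret (flipAt (D.block t) b) A t ω := by
  by_cases hb : b (D.block t) = false
  · exact D.le_seedRegret_add_of_false b A ht hn hb ω
  · have := D.le_seedRegret_add_of_false (flipAt (D.block t) b) A ht hn (by simpa using hb) ω
    rwa [flipAt_involutive, add_comm] at this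

/-- For each noisy step, pair `b` with its flip at the block of that step: the sum over `b` is
counted twice, hence `8` in place of `4`. The other steps have nonnegative regret. -/
lemma le_sum_seedRegret {n : ℕ} (hn : ∀ t ∈ D.noisy,
    ((D.noisy.erase t).filter fun s => D.block s = D.block t).card ≤ n) (ω : Ω) :
    2 ^ Γ * (D.noisy.card * (D.gap / 8 * (1 - D.gap ^ 2) ^ n)) ≤
      ∑ b, ∑ t, D.seedRegret b A t ω := by
  rw [Finset.sum_comm]
  refine le_trans ?_ (Finset.sum_le_sum_of_subset_of_nonneg (Finset.subset_univ D.noisy)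
    fun t _ _ => Finset.sum_nonneg fun b _ => D.seedRegret_nonneg b A t ω)
  rw [mul_left_comm, ← nsmul_eq_mul]
  refine Finset.card_nsmul_le_sum _ _ _ fun t ht => ?_
  have h1 := Finset.card_nsmul_le_sum (Finset.univ : Finset (Fin Γ → Bool)) _ _
    fun b _ => D.le_seedRegret_add b A ht (hn t ht) ω
  rw [Finset.sum_add_distrib, sum_flipAt (D.block t) fun b => D.seedRegret b A t ω] at h1
  simp only [Finset.card_univ, Fintype.card_pi, Fintype.card_bool, Finset.prod_const,
    Fintype.card_fin, nsmul_eq_mul, Nat.cast_pow, Nat.cast_ofNat] at h1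
  linarith

/-- The action is chosen before the sign at `t` is seen, so the centred noise averages out. -/
lemma sum_signVectorWeight_lossVal (t : Fin T) (ω : Ω) :
    ∑ x, signVectorWeight (D.signMean b) x * D.lossVal b t (D.action b A t ω x) (x t) =
      D.seedRegret b A t ω + D.bestVal b t := by
  have := sum_signVectorWeight_mul_sub (D.signMean b) t
    (h := fun x => if (D.action b A t ω x).val = 0 ∧ t ∈ D.noisy then (1 / 2 : ℝ) else 0)
    fun x => by simp only [action_flipAt]
  simp only [lossVal_eq, seedRegret, mul_add, mul_sub, Finset.sum_add_distrib,
    Finset.sum_sub_distrib, ← Finset.sum_mul, sum_signVectorWeight] at this ⊢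
  linarith

/-! ### Measurability and integration over the seed -/

lemma _root_.measurable_eval_eval (t : Fin T) :
    Measurable fun p : (Fin T → Fin K → unitInterval) × Fin K => p.1 t p.2 :=
  measurable_from_prod_countable_left fun i =>
    (measurable_pi_apply i).comp (measurable_pi_apply t)

lemma _root_.FullInfoAlgorithm.measurable_play (t : Fin T) :
    Measurable fun z : Ω × (Fin T → Fin K → unitInterval) => A.play t z.1 z.2 :=
  (A.measurable_act t).comp (measurable_fst.prodMk (measurable_pi_lambda _ fun s =>
    (measurable_pi_apply (Fin.castLE t.isLt.le s)).comp measurable_snd))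

lemma _root_.FullInfoAlgorithm.measurable_loss_play (t : Fin T) :
    Measurable fun z : Ω × (Fin T → Fin K → unitInterval) =>
      ((z.2 t (A.play t z.1 z.2) : unitInterval) : ℝ) :=
  measurable_subtype_coe.comp
    ((measurable_eval_eval t).comp (measurable_snd.prodMk (A.measurable_play t)))

lemma _root_.FullInfoAlgorithm.integrable_loss_play (t : Fin T)
    (Q : Measure (Ω × (Fin T → Fin K → unitInterval))) [IsFiniteMeasure Q] :
    Integrable (fun z => ((z.2 t (A.play t z.1 z.2) : unitInterval) : ℝ)) Q :=
  Integrable.of_bound (A.measurable_loss_play t).aestronglyMeasurable 1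
    (.of_forall fun z => by
      rw [Real.norm_of_nonneg (z.2 t (A.play t z.1 z.2)).2.1]
      exact (z.2 t (A.play t z.1 z.2)).2.2)

lemma integral_loss_play (hK : 2 ≤ K) (t : Fin T) (ω : Ω) :
    ∫ ℓ, ((ℓ t (A.play t ω ℓ) : unitInterval) : ℝ) ∂(D.env b K).jointLaw =
      D.seedRegret b A t ω + D.bestVal b t := by
  have hmeas : Measurable fun ℓ : Fin T → Fin K → unitInterval =>
      ((ℓ t (A.play t ω ℓ) : unitInterval) : ℝ) :=
    (A.measurable_loss_play t).comp measurable_prodMk_left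
  rw [D.jointLaw_env b hK, integral_map (measurable_of_countable _).aemeasurable
    hmeas.aestronglyMeasurable,
    integral_pi_signMeasure (D.abs_signMean_le b), ← sum_signVectorWeight_lossVal]
  rfl

variable (P : Measure Ω) [IsProbabilityMeasure P]

lemma integrable_seedRegret (hK : 2 ≤ K) (t : Fin T) : Integrable (D.seedRegret b A t) P := by
  have := (A.integrable_loss_play t (P.prod (D.env b K).jointLaw)).integral_prod_left
  simp only [D.integral_loss_play b A hK] at this
  exact (this.sub (integrable_const (D.bestVal b t))).congr (.of_forall fun ω => by simp)

lemma integral_seedRegret_le_regret (hK : 2 ≤ K) :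
    ∫ ω, ∑ t, D.seedRegret b A t ω ∂P ≤ A.regret P (D.env b K) := by
  rw [integral_finsetSum _ fun t _ => D.integrable_seedRegret b A P hK t]
  refine Finset.sum_le_sum fun t _ => ?_
  rw [integral_prod _ (A.integrable_loss_play t _)]
  simp only [D.integral_loss_play b A hK]
  rw [integral_add (D.integrable_seedRegret b A P hK t) (integrable_const _)]
  have := D.iInf_mean_env_le b hK t
  simp only [integral_const, probReal_univ, one_smul]
  linarith

/-- Some sign pattern forces regret proportional to the gap in every noisy step. -/
theorem exists_le_regret (hK : 2 ≤ K) {n : ℕ} (hn : ∀ t ∈ D.noisy,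
    ((D.noisy.erase t).filter fun s => D.block s = D.block t).card ≤ n) :
    ∃ b, D.noisy.card * (D.gap / 8 * (1 - D.gap ^ 2) ^ n) ≤ A.regret P (D.env b K) := by
  have hint : ∀ b, Integrable (fun ω => ∑ t, D.seedRegret b A t ω) P := fun b =>
    integrable_finsetSum _ fun t _ => D.integrable_seedRegret b A P hK t
  have h1 := integral_mono (integrable_const _) (integrable_finsetSum Finset.univ
    fun b _ => hint b) (D.le_sum_seedRegret A hn)
  rw [integral_finsetSum _ fun b _ => hint b] at h1
  simp only [integral_const, probReal_univ, one_smul] at h1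
  have h2 := h1.trans (Finset.sum_le_sum fun b _ => D.integral_seedRegret_le_regret b A P hK)
  by_contra! hlt
  have h3 := Finset.sum_lt_sum_of_nonempty Finset.univ_nonempty fun b _ => hlt b
  simp only [Finset.sum_const, Finset.card_univ, Fintype.card_pi, Fintype.card_bool,
    Finset.prod_const, Fintype.card_fin, nsmul_eq_mul, Nat.cast_pow, Nat.cast_ofNat] at h3
  linarith

end BlockDesign

/-! ### Consecutive blocks -/

namespace BlockDesign

/-- Consecutive blocks of `L` steps, of which the last one is continued without noise. -/
def consecutive (T Γ L : ℕ) (hΓ : 1 ≤ Γ) (δ : ℝ) (h0 : 0 ≤ δ) (h1 : δ ≤ 1) : BlockDesign T Γ where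
  block t := ⟨min (t.val / L) (Γ - 1), by omega⟩
  noisy := Finset.univ.filter fun t => t.val < Γ * L
  gap := δ
  gap_nonneg := h0
  gap_le_one := h1
  noisy_of_lt s t hst ht := by
    simp only [Finset.mem_filter, Finset.mem_univ, true_and] at ht ⊢
    exact lt_trans hst ht

variable {K T Γ L : ℕ} {hΓ : 1 ≤ Γ} {δ : ℝ} {h0 : 0 ≤ δ} {h1 : δ ≤ 1}

lemma card_noisy_consecutive (hT : Γ * L ≤ T) :
    (consecutive T Γ L hΓ δ h0 h1).noisy.card = Γ * L := by
  simp [consecutive, Fin.card_filter_val_lt, hT]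

/-- Inside a block a step is determined by its residue mod `L`, and the residue of `t` is excluded.
-/
lemma card_filter_block_consecutive_le {t : Fin T}
    (ht : t ∈ (consecutive T Γ L hΓ δ h0 h1).noisy) (hL : 1 ≤ L) :
    (((consecutive T Γ L hΓ δ h0 h1).noisy.erase t).filter fun s =>
      (consecutive T Γ L hΓ δ h0 h1).block s = (consecutive T Γ L hΓ δ h0 h1).block t).card ≤
        L - 1 := by
  have hlt : ∀ s : Fin T, s.val < Γ * L → s.val / L ≤ Γ - 1 := fun s hs =>
    Nat.le_sub_one_of_lt (Nat.div_lt_of_lt_mul (by rwa [mul_comm]))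
  have hdiv : ∀ s ∈ ((consecutive T Γ L hΓ δ h0 h1).noisy.erase t).filter fun s =>
      (consecutive T Γ L hΓ δ h0 h1).block s = (consecutive T Γ L hΓ δ h0 h1).block t,
      s ≠ t ∧ s.val / L = t.val / L := by
    intro s hs
    simp only [consecutive, Finset.mem_filter, Finset.mem_erase, Finset.mem_univ, true_and,
      Fin.mk.injEq] at hs ht
    have := hlt s hs.1.2
    have := hlt t ht
    exact ⟨hs.1.1, by omega⟩
  have hinj : ∀ s s' : Fin T, s.val / L = s'.val / L → s.val % L = s'.val % L → s = s' :=
    fun s s' hd hm => Fin.ext (by rw [← Nat.div_add_mod s.val L, hd, hm, Nat.div_add_mod])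
  have hcard : ((Finset.range L).erase (t.val % L)).card = L - 1 := by
    rw [Finset.card_erase_of_mem (Finset.mem_range.2 (Nat.mod_lt _ hL)), Finset.card_range]
  rw [← hcard]
  refine Finset.card_le_card_of_injOn (fun s => s.val % L) (fun s hs => ?_) fun s hs s' hs' h => ?_
  · obtain ⟨hne, hd⟩ := hdiv s hs
    exact Finset.mem_coe.2 (Finset.mem_erase.2
      ⟨fun hm => hne (hinj s t hd hm), Finset.mem_range.2 (Nat.mod_lt _ hL)⟩)
  · exact hinj s s' ((hdiv s hs).2.trans (hdiv s' hs').2.symm) h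

/-- The mean can change only at `t = L * q` with `1 ≤ q < Γ`, so `t ↦ t / L` injects the changes
into `Ico 1 Γ`. -/
lemma numIntervals_consecutive_le (b : Fin Γ → Bool) :
    ((consecutive T Γ L hΓ δ h0 h1).env b K).numIntervals ≤ Γ := by
  have hstep : ∀ t : Fin T, (∃ s : Fin T, s.val + 1 = t.val ∧
      ((consecutive T Γ L hΓ δ h0 h1).env b K).mean t ≠
        ((consecutive T Γ L hΓ δ h0 h1).env b K).mean s) →
      t.val = L * (t.val / L) ∧ 1 ≤ t.val / L ∧ t.val / L < Γ := by
    rintro t ⟨s, hs, hne⟩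
    have hb : min (s.val / L) (Γ - 1) ≠ min (t.val / L) (Γ - 1) := by
      intro h
      apply hne
      ext i
      simp [mean_env, meanVal, consecutive, h]
    have hsucc : t.val / L = s.val / L + if L ∣ s.val + 1 then 1 else 0 := by
      rw [← hs, Nat.succ_div]
    split_ifs at hsucc with hdvd
    · rw [hs] at hdvd
      exact ⟨(Nat.mul_div_cancel' hdvd).symm, hsucc ▸ Nat.le_add_left _ _, by omega⟩
    · exact absurd (by rw [hsucc, add_zero]) hb
  unfold LossEnvironment.numIntervals
  refine (Nat.add_le_add_left (Finset.card_le_card_of_injOn (t := Finset.Ico 1 Γ)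
    (fun t : Fin T => t.val / L) (fun t ht => ?_) fun t ht t' ht' h => ?_) 1).trans ?_
  · exact Finset.mem_coe.2 (Finset.mem_Ico.2 (hstep t (by simpa using ht)).2)
  · have e := (hstep t (by simpa using ht)).1
    have e' := (hstep t' (by simpa using ht')).1
    dsimp only at h
    exact Fin.ext (by rw [e, h, ← e'])
  · rw [Nat.card_Ico]
    omega

end BlockDesign

/-! ### Choice of the parameters -/

/-- Regret lower bound for blocks of `L` steps with gap `δ`. -/
theorem FullInfoAlgorithm.exists_env_le_regret {K T Γ L : ℕ} {Λ δ : ℝ} (hK : 2 ≤ K) (hΓ : 1 ≤ Γ)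
    (hL : 1 ≤ L) (hT : Γ * L ≤ T) (h0 : 0 ≤ δ) (h1 : δ ≤ 1) (hδ : 1 / 2 ≤ (1 - δ ^ 2) ^ (L - 1))
    (hΛ : Γ * L * ((1 - δ ^ 2) / 4) ≤ Λ) {Ω : Type*} [MeasurableSpace Ω] (P : Measure Ω)
    [IsProbabilityMeasure P] (A : FullInfoAlgorithm K T Ω) :
    ∃ E : LossEnvironment K T, E.numIntervals ≤ Γ ∧ E.totalVariance ≤ Λ ∧
      Γ * L * δ / 16 ≤ A.regret P E := by
  set D := BlockDesign.consecutive T Γ L hΓ δ h0 h1 with hD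
  have hcard : (D.noisy.card : ℝ) = Γ * L := by
    rw [hD, BlockDesign.card_noisy_consecutive hT, Nat.cast_mul]
  obtain ⟨b, hb⟩ := D.exists_le_regret A P hK (n := L - 1)
    fun t ht => BlockDesign.card_filter_block_consecutive_le ht hL
  refine ⟨D.env b K, BlockDesign.numIntervals_consecutive_le b, ?_, ?_⟩
  · rw [D.totalVariance_env b hK, hcard]
    exact hΛ
  · refine le_trans ?_ hb
    rw [hcard]
    change (Γ : ℝ) * L * δ / 16 ≤ Γ * L * (δ / 8 * (1 - δ ^ 2) ^ (L - 1))
    have : (0 : ℝ) ≤ Γ * L * δ / 8 := by positivity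
    nlinarith [mul_le_mul_of_nonneg_left hδ this]

end

theorem mainTheorem7 (C : ℝ) (hC : 0 < C) :
    ∃ c : ℝ, 0 < c ∧
      ∀ (K T Γ : ℕ) (Λ : ℝ), 2 ≤ K → 1 ≤ Γ → Γ ≤ T → 0 ≤ Λ → Λ ≤ C * T →
        ∀ (Ω : Type*) [MeasurableSpace Ω] (P : Measure Ω) [IsProbabilityMeasure P]
          (A : FullInfoAlgorithm K T Ω),
          ∃ E : LossEnvironment K T, E.numIntervals ≤ Γ ∧ E.totalVariance ≤ Λ ∧
            c * (Real.sqrt (Γ * Λ) + Γ) ≤ A.regret P E := by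
  set M := max 1 C with hM
  have hM1 : 1 ≤ M := le_max_left _ _
  have hM0 : 0 < M := by linarith
  have hsM : 1 ≤ √M := Real.one_le_sqrt.2 hM1
  -- In the main case the regret is at least `Γ√(2L)/32`, while `√(ΓΛ) + Γ ≤ 2√M Γ√(2L)`.
  refine ⟨1 / (64 * √M), by positivity, ?_⟩
  intro K T Γ Λ hK hΓ hΓT hΛ0 hΛC Ω _ P _ A
  have hΓ0 : (1 : ℝ) ≤ Γ := by exact_mod_cast hΓ
  have hΓT' : (Γ : ℝ) ≤ T := by exact_mod_cast hΓT
  rcases le_total Λ Γ with hle | hge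
  -- Gap `1` makes the losses deterministic, so the variance is `0`; the sign of each one-step block
  -- is unknown when it is played.
  · obtain ⟨E, hE, hE', hr⟩ := A.exists_env_le_regret (L := 1) (δ := 1) (Λ := Λ) hK hΓ le_rfl
      (by simpa using hΓT) zero_le_one le_rfl (by norm_num) (by simpa using hΛ0) P
    refine ⟨E, hE, hE', le_trans ?_ hr⟩
    have hs : √(Γ * Λ) ≤ Γ := Real.sqrt_le_iff.2 ⟨by linarith, by nlinarith⟩
    have hc : 1 / (64 * √M) ≤ 1 / 64 := one_div_le_one_div_of_le (by norm_num) (by linarith)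
    calc 1 / (64 * √M) * (√(Γ * Λ) + Γ) ≤ 1 / 64 * (Γ + Γ) := by gcongr
      _ ≤ _ := by push_cast; linarith
  -- The noisy steps must fit both the horizon and the variance budget; `M` absorbs the loss when `Λ
  -- > T`.
  · set m := min (T : ℝ) Λ with hm
    have hmΓ : (Γ : ℝ) ≤ m := le_min hΓT' hge
    set L := ⌊m / Γ⌋₊ with hLdef
    have hm0 : 0 ≤ m / Γ := by positivity
    have hL : 1 ≤ L := Nat.le_floor (by rw [Nat.cast_one, one_le_div (by linarith)]; exact hmΓ)
    have hL1 : (1 : ℝ) ≤ L := by exact_mod_cast hL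
    have hLm : Γ * (L : ℝ) ≤ m := by
      have := Nat.floor_le hm0
      rw [le_div_iff₀ (by linarith)] at this
      linarith
    have hmL : m ≤ 2 * Γ * L := by
      have := Nat.lt_floor_add_one (m / Γ)
      rw [div_lt_iff₀ (by linarith)] at this
      nlinarith
    have hT : Γ * L ≤ T := by exact_mod_cast hLm.trans (min_le_left _ _)
    have hΛM : Λ ≤ M * m := by
      rw [hm, mul_min_of_nonneg _ _ hM0.le]
      exact le_min (hΛC.trans (by gcongr; exact le_max_right _ _)) (by nlinarith)
    set δ := 1 / √(2 * L) with hδ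
    have hsL : 1 ≤ √(2 * L) := Real.one_le_sqrt.2 (by linarith)
    have hδ0 : 0 ≤ δ := by positivity
    have hδ1 : δ ≤ 1 := (div_le_one (by linarith)).2 hsL
    have hδsq : δ ^ 2 = 1 / (2 * L) := by
      rw [hδ, div_pow, Real.sq_sqrt (by positivity), one_pow]
    have hpow : 1 / 2 ≤ (1 - δ ^ 2) ^ (L - 1) := by
      -- Bernoulli's inequality: `(1 - 1/(2L))^(L-1) ≥ 1 - (L-1)/(2L) ≥ 1/2`.
      have hb := one_add_mul_le_pow (a := -δ ^ 2) (by nlinarith) (L - 1)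
      rw [Nat.cast_sub hL, Nat.cast_one] at hb
      have : L * δ ^ 2 = 1 / 2 := by rw [hδsq]; field_simp
      rw [sub_eq_add_neg]
      nlinarith [sq_nonneg δ]
    obtain ⟨E, hE, hE', hr⟩ := A.exists_env_le_regret (Λ := Λ) hK hΓ hL hT hδ0 hδ1 hpow
      (by nlinarith [hLm.trans (min_le_right _ _), sq_nonneg δ,
        mul_nonneg (by positivity : (0 : ℝ) ≤ Γ * L) (sq_nonneg δ)]) P
    refine ⟨E, hE, hE', le_trans ?_ hr⟩
    have hs : (Γ : ℝ) ≤ √(Γ * Λ) := Real.le_sqrt_of_sq_le (by nlinarith)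
    have hsqrt : √(Γ * Λ) ≤ √M * (Γ * √(2 * L)) := by
      rw [← Real.sqrt_sq (by linarith : (0 : ℝ) ≤ Γ), ← Real.sqrt_mul (sq_nonneg _),
        ← Real.sqrt_mul hM0.le, Real.sqrt_sq (by linarith : (0 : ℝ) ≤ Γ)]
      apply Real.sqrt_le_sqrt
      calc (Γ : ℝ) * Λ ≤ Γ * (M * (2 * Γ * L)) := by gcongr; exact hΛM.trans (by gcongr)
        _ = _ := by ring
    have hLδ : L * δ = √(2 * L) / 2 := by
      rw [hδ, mul_one_div, div_eq_div_iff (by linarith) two_ne_zero,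
        Real.mul_self_sqrt (by positivity)]
      ring
    calc 1 / (64 * √M) * (√(Γ * Λ) + Γ) ≤ 1 / (64 * √M) * (2 * (√M * (Γ * √(2 * L)))) := by
          gcongr; linarith
      _ = Γ * (√(2 * L) / 2) / 16 := by field_simp; norm_num
      _ = Γ * L * δ / 16 := by rw [← hLδ]; ring
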